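/- Let $(\mathcal M,\otimes,\mathbb I,l,r)$ be an abelian monoidal category with additive tensor product which is right exact in each variable, locally small in the sense that the subobjects of every object form a set, and bicomplete (all small limits and colimits). Assume that $\mathcal M$ is Penrose: for all $t:\mathbb I\to\mathbb I$ and $f:X\to Y$ one has $t\otimes f=f\otimes t$ modulo the unit constraints $\mathbb I\otimes X\cong X\cong X\otimes\mathbb I$ and $\mathbb I\otimes Y\cong Y\cong Y\otimes\mathbb I$. Let $(A,m,u)$ be a monoid in $\mathcal M$. *Notation.* For an object or monoid $B$ put $\mathcal Z(B)=\mathrm{Hom}_{\mathcal M}(\mathbb I,B)$. Then $\mathcal Z(\mathbb I)$ is a commutative ring under composition and $\mathcal Z(A)$ is a $\mathcal Z(\mathbb I)$-algebra with product $s*t=m\circ(s\otimes t)\circ(\mathbb I\cong\mathbb I\otimes\mathbb I)$, unit $u$ and structure map $t\mapsto u\circ t$. For $t\in\mathcal Z(A)$ and $f:X\to A$ put $t\triangleright f=m\circ(t\otimes f)\circ l_X^{-1}$ and $f\triangleleft t=m\circ(f\otimes t)\circ r_X^{-1}$, and write $A$ also for $\mathrm{id}_A$. For $\mathcal Z(\mathbb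 I)$-linear maps $\sigma,\delta:\mathcal Z(A)\to\mathcal Z(A)$ let $${}_\sigma J_\delta=\bigcap_{t\in\mathcal Z(A)}\mathrm{Eq}\big(\sigma(t)\triangleright A,\;A\triangleleft\delta(t)\big)\subseteq A ,$$ where the index $1$ stands for the identity map. The multiplication of $A$ induces morphisms $m^\delta_{\sigma,\gamma}:{}_\sigma J_\delta\otimes{}_\delta J_\gamma\to{}_\sigma J_\gamma$ and the unit induces $u_\sigma:\mathbb I\to{}_\sigma J_\sigma$; these make ${}_\sigma J_\sigma$ a monoid and ${}_\sigma J_\delta$ an $({}_\sigma J_\sigma,{}_\delta J_\delta)$-bimodule, and $m^\delta_{\sigma,\gamma}$ induces $\overline m^\delta_{\sigma,\gamma}:{}_\sigma J_\delta\otimes_{{}_\delta J_\delta}{}_\delta J_\gamma\to{}_\sigma J_\gamma$. Let $$\mathcal G(\mathcal Z(A))=\{\theta\in\mathrm{Aut}_{\mathcal Z(\mathbb I)\text{-alg}}(\mathcal Z(A)) : \overline m^{1}_{\theta,\theta}\text{ and }\overline m^{\theta}_{1,1}\text{ are isomorphisms}\},$$ the set of those $\theta$ for which ${}_\theta J_1$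 is two-sided invertible. A subobject $i_X:X\hookrightarrow A$ is two-sided invertible if there are a subobject $i_Y:Y\hookrightarrow A$ and isomorphisms $m_X:X\otimes Y\to\mathbb I$ and $m_Y:Y\otimes X\to\mathbb I$ with $u\circ m_X=m\circ(i_X\otimes i_Y)$ and $u\circ m_Y=m\circ(i_Y\otimes i_X)$. When $u$ is a monomorphism, the set $\mathrm{Inv}_{\mathbb I}(A)$ of two-sided invertible subobjects is a group, where the product of $X$ and $X'$ is $X\otimes X'$ with the monomorphism $m\circ(i_X\otimes i_{X'})$ and the neutral element is $u:\mathbb I\to A$. For $X\in\mathrm{Inv}_{\mathbb I}(A)$ with inverse $Y$ the map $$\Phi_X:\mathcal Z(A)\to\mathcal Z(A),\qquad \Phi_X(t)=m\circ\big(i_X\otimes(t\triangleright i_Y)\big)\circ m_X^{-1}$$ is a $\mathcal Z(\mathbb I)$-algebra automorphism which does not depend on the choice of $Y$. The Miyashita action is the map $\Phi:X\mapsto\Phi_X$. **Theorem.** Assume that $u_1:\mathbb I\to{}_1J_1$ is an isomorphism (so that $u$ is a monomorphism). Then $\mathcal G(\mathcal Z(A))$ is a subgroup of $\mathrm{Aut}_{\mathcal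 Z(\mathbb I)\text{-alg}}(\mathcal Z(A))$, and $\Phi$ corestricts to an isomorphism of groups $\widehat\Phi:\mathrm{Inv}_{\mathbb I}(A)\to\mathcal G(\mathcal Z(A))$, that is, $\Phi=\varsigma\circ\widehat\Phi$ with $\varsigma$ the inclusion of $\mathcal G(\mathcal Z(A))$. Moreover $\widehat\Phi^{-1}(\theta)={}_\theta J_1$ for every $\theta\in\mathcal G(\mathcal Z(A))$. -/

import Mathlib

open CategoryTheory MonoidalCategory Limits
open scoped MonObj

set_option linter.unusedSectionVars false

universe v u

noncomputable section

namespace Miyashita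

variable {C : Type u} [Category.{v} C] [MonoidalCategory C]

/-! ### Penrose categories and the algebra of invariants -/

/-- A monoidal category is Penrose if every hom-set is a central module over the endomorphisms of
the unit object: the left action `t ⊗ f` and the right action `f ⊗ t` of `t : 𝟙 ⟶ 𝟙` on
`f : X ⟶ Y` coincide, modulo the unit constraints. -/
class Penrose (C : Type u) [Category.{v} C] [MonoidalCategory C] : Prop where
  central : ∀ {X Y : C} (t : 𝟙_ C ⟶ 𝟙_ C) (f : X ⟶ Y),
    (λ_ X).inv ≫ (t ⊗ₘ f) ≫ (λ_ Y).hom = (ρ_ X).inv ≫ (f ⊗ₘ t) ≫ (ρ_ Y).hom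

theorem unit_end_comm (s t : 𝟙_ C ⟶ 𝟙_ C) : s ≫ t = t ≫ s := by
  have h1 : s ≫ t = (λ_ (𝟙_ C)).inv ≫ (t ⊗ₘ s) ≫ (λ_ (𝟙_ C)).hom := by
    rw [MonoidalCategory.tensorHom_def', Category.assoc, unitors_equal, rightUnitor_naturality,
      ← unitors_equal, leftUnitor_naturality_assoc, Iso.inv_hom_id_assoc]
  have h2 : t ≫ s = (λ_ (𝟙_ C)).inv ≫ (t ⊗ₘ s) ≫ (λ_ (𝟙_ C)).hom := by
    rw [MonoidalCategory.tensorHom_def, Category.assoc, leftUnitor_naturality, unitors_inv_equal, unitors_equal,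
      rightUnitor_naturality_assoc, Iso.inv_hom_id_assoc]
  rw [h1, h2]

/-- `Z(𝟙)`, the commutative endomorphism ring of the unit object. -/
instance [Preadditive C] : CommRing (End (𝟙_ C)) :=
  { (inferInstance : Ring (End (𝟙_ C))) with
    mul_comm := fun s t => unit_end_comm t s }

/-- The product `m ∘ (f ⊗ g) : X ⊗ Y ⟶ A` of two morphisms into a monoid. -/
def star {X Y A : C} [MonObj A] (f : X ⟶ A) (g : Y ⟶ A) : X ⊗ Y ⟶ A :=
  (f ⊗ₘ g) ≫ μ[A]

/-- The left action `t ▷ f` of `t : 𝟙 ⟶ A` on `f : X ⟶ A`. -/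
def lact {X A : C} [MonObj A] (t : 𝟙_ C ⟶ A) (f : X ⟶ A) : X ⟶ A :=
  (λ_ X).inv ≫ (t ⊗ₘ f) ≫ μ[A]

/-- The right action `f ◁ t` of `t : 𝟙 ⟶ A` on `f : X ⟶ A`. -/
def ract {X A : C} [MonObj A] (f : X ⟶ A) (t : 𝟙_ C ⟶ A) : X ⟶ A :=
  (ρ_ X).inv ≫ (f ⊗ₘ t) ≫ μ[A]

section Calculus

variable {A X Y W X' Y' : C} [MonObj A]

theorem lact_eq (t : 𝟙_ C ⟶ A) (f : X ⟶ A) : lact t f = (λ_ X).inv ≫ star t f := rfl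

theorem ract_eq (f : X ⟶ A) (t : 𝟙_ C ⟶ A) : ract f t = (ρ_ X).inv ≫ star f t := rfl

theorem tensor_star (a : X' ⟶ X) (b : Y' ⟶ Y) (f : X ⟶ A) (g : Y ⟶ A) :
    (a ⊗ₘ b) ≫ star f g = star (a ≫ f) (b ≫ g) := by
  simp [star]

theorem star_comp_left (a : X' ⟶ X) (f : X ⟶ A) (g : Y ⟶ A) :
    star (a ≫ f) g = a ▷ Y ≫ star f g := by
  rw [← tensorHom_id, tensor_star, Category.id_comp]

theorem star_comp_right (f : X ⟶ A) (b : Y' ⟶ Y) (g : Y ⟶ A) :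
    star f (b ≫ g) = X ◁ b ≫ star f g := by
  rw [← id_tensorHom, tensor_star, Category.id_comp]

theorem star_assoc (f : X ⟶ A) (g : Y ⟶ A) (h : W ⟶ A) :
    star (star f g) h = (α_ X Y W).hom ≫ star f (star g h) := by
  have e1 : star (star f g) h = ((f ⊗ₘ g) ⊗ₘ h) ≫ μ[A] ▷ A ≫ μ[A] := by
    rw [star, star, ← tensorHom_id, tensorHom_comp_tensorHom_assoc, Category.comp_id]
  have e2 : star f (star g h) = (f ⊗ₘ (g ⊗ₘ h)) ≫ A ◁ μ[A] ≫ μ[A] := by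
    rw [star, star, ← id_tensorHom, tensorHom_comp_tensorHom_assoc, Category.comp_id]
  rw [e1, e2, MonObj.mul_assoc, associator_naturality_assoc]

theorem one_star (f : X ⟶ A) : star η[A] f = (λ_ X).hom ≫ f := by
  rw [star, tensorHom_def', Category.assoc, MonObj.one_mul, leftUnitor_naturality]

theorem star_one (f : X ⟶ A) : star f η[A] = (ρ_ X).hom ≫ f := by
  rw [star, MonoidalCategory.tensorHom_def, Category.assoc, MonObj.mul_one, rightUnitor_naturality]

theorem lact_comp (t : 𝟙_ C ⟶ A) (a : X' ⟶ X) (f : X ⟶ A) : lact t (a ≫ f) = a ≫ lact t f := by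
  rw [lact_eq, lact_eq, star_comp_right, leftUnitor_inv_naturality_assoc]

theorem ract_comp (a : X' ⟶ X) (f : X ⟶ A) (t : 𝟙_ C ⟶ A) : ract (a ≫ f) t = a ≫ ract f t := by
  rw [ract_eq, ract_eq, star_comp_left, rightUnitor_inv_naturality_assoc]

theorem one_lact (f : X ⟶ A) : lact η[A] f = f := by
  rw [lact_eq, one_star, Iso.inv_hom_id_assoc]

theorem ract_one (f : X ⟶ A) : ract f η[A] = f := by
  rw [ract_eq, star_one, Iso.inv_hom_id_assoc]

theorem lact_one (t : 𝟙_ C ⟶ A) : lact t η[A] = t := by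
  rw [lact_eq, star_one, ← unitors_equal, Iso.inv_hom_id_assoc]

theorem one_ract (t : 𝟙_ C ⟶ A) : ract η[A] t = t := by
  rw [ract_eq, one_star, unitors_equal, Iso.inv_hom_id_assoc]

theorem lact_eq_ract (s t : 𝟙_ C ⟶ A) : lact s t = ract s t := by
  rw [lact_eq, ract_eq, unitors_inv_equal]

theorem lact_star (t : 𝟙_ C ⟶ A) (f : X ⟶ A) (g : Y ⟶ A) :
    lact t (star f g) = star (lact t f) g := by
  rw [lact_eq, lact_eq, star_comp_left, star_assoc, leftUnitor_tensor_inv, Category.assoc]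

theorem star_ract (f : X ⟶ A) (g : Y ⟶ A) (t : 𝟙_ C ⟶ A) :
    ract (star f g) t = star f (ract g t) := by
  rw [ract_eq, ract_eq, star_comp_right, star_assoc, rightUnitor_tensor_inv, Category.assoc,
    Iso.inv_hom_id_assoc]

theorem ract_star (f : X ⟶ A) (t : 𝟙_ C ⟶ A) (g : Y ⟶ A) :
    star (ract f t) g = star f (lact t g) := by
  rw [ract_eq, lact_eq, star_comp_left, star_comp_right, star_assoc]
  rw [← Category.assoc]
  congr 1
  monoidal

theorem lact_lact (s t : 𝟙_ C ⟶ A) (f : X ⟶ A) : lact (lact s t) f = lact s (lact t f) := by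
  rw [lact_eq (lact s t), ← lact_star, lact_eq t, lact_comp]

theorem ract_ract (f : X ⟶ A) (s t : 𝟙_ C ⟶ A) : ract (ract f s) t = ract f (ract s t) := by
  rw [ract_eq f (ract s t), ← star_ract, ract_eq f s, ract_comp]

theorem lact_ract (s : 𝟙_ C ⟶ A) (f : X ⟶ A) (t : 𝟙_ C ⟶ A) :
    ract (lact s f) t = lact s (ract f t) := by
  rw [lact_eq, ract_comp, star_ract, ← lact_eq]

theorem scalar_lact [Penrose C] (s : 𝟙_ C ⟶ 𝟙_ C) (f : X ⟶ A) :
    lact (s ≫ η[A]) f = ract f (s ≫ η[A]) := by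
  have h := Penrose.central s f
  rw [lact_eq, ract_eq, star_comp_left, star_comp_right, one_star, star_one]
  rw [MonoidalCategory.tensorHom_def, MonoidalCategory.tensorHom_def'] at h
  simp only [Category.assoc, leftUnitor_naturality, rightUnitor_naturality] at h
  exact h

end Calculus

section Invariants

variable [Preadditive C] [MonoidalPreadditive C]

/-- `Z(A) = Hom(𝟙, A)`, the algebra of invariants of a monoid `A`. -/
def Z (A : C) : Type v := 𝟙_ C ⟶ A

instance (A : C) : AddCommGroup (Z A) := inferInstanceAs (AddCommGroup (𝟙_ C ⟶ A))

theorem lact_add {X A : C} [MonObj A] (t : 𝟙_ C ⟶ A) (f g : X ⟶ A) :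
    lact t (f + g) = lact t f + lact t g := by
  simp [lact, MonoidalPreadditive.tensor_add]

theorem add_lact {X A : C} [MonObj A] (s t : 𝟙_ C ⟶ A) (f : X ⟶ A) :
    lact (s + t) f = lact s f + lact t f := by
  simp [lact, MonoidalPreadditive.add_tensor]

theorem zero_lact {X A : C} [MonObj A] (f : X ⟶ A) : lact 0 f = 0 := by
  simp [lact]

theorem lact_zero {X A : C} [MonObj A] (t : 𝟙_ C ⟶ A) : lact t (0 : X ⟶ A) = 0 := by
  simp [lact]

theorem ract_add {X A : C} [MonObj A] (f : X ⟶ A) (s t : 𝟙_ C ⟶ A) :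
    ract f (s + t) = ract f s + ract f t := by
  simp [ract, MonoidalPreadditive.tensor_add]

/-- The morphism underlying an element of `Z(A)`. -/
def Z.hom {A : C} (t : Z A) : 𝟙_ C ⟶ A := t

/-- A morphism `𝟙 ⟶ A` as an element of `Z(A)`. -/
def Z.of {A : C} (t : 𝟙_ C ⟶ A) : Z A := t

/-- The convolution product: `s * t = m ∘ (s ⊗ t) ∘ (𝟙 ≅ 𝟙 ⊗ 𝟙)`, with unit the unit of `A`. -/
instance (A : C) [MonObj A] : Ring (Z A) :=
  { (inferInstance : AddCommGroup (Z A)) with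
    mul := fun s t => Z.of ((λ_ (𝟙_ C)).inv ≫ (s.hom ⊗ₘ t.hom) ≫ μ[A])
    one := Z.of η[A]
    mul_assoc := fun s t r => lact_lact s.hom t.hom r.hom
    one_mul := fun s => one_lact s.hom
    mul_one := fun s => lact_one s.hom
    left_distrib := fun s t r => lact_add s.hom t.hom r.hom
    right_distrib := fun s t r => add_lact s.hom t.hom r.hom
    zero_mul := fun s => zero_lact s.hom
    mul_zero := fun s => lact_zero s.hom }

theorem Z.mul_hom {A : C} [MonObj A] (s t : Z A) : (s * t).hom = lact s.hom t.hom := rfl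

theorem Z.add_hom {A : C} [MonObj A] (s t : Z A) : (s + t).hom = s.hom + t.hom := rfl

theorem Z.hom_injective {A : C} {s t : Z A} (h : s.hom = t.hom) : s = t := h

theorem algebra_comm {A : C} [MonObj A] (t : 𝟙_ C ⟶ 𝟙_ C) (s : 𝟙_ C ⟶ A) :
    lact (t ≫ η[A]) s = lact s (t ≫ η[A]) := by
  rw [lact_eq_ract, ract_comp, one_ract, lact_comp, lact_one]

theorem algebra_smul {A : C} [MonObj A] (t : 𝟙_ C ⟶ 𝟙_ C) (s : 𝟙_ C ⟶ A) :
    t ≫ s = lact (t ≫ η[A]) s := by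
  rw [lact_eq_ract, ract_comp, one_ract]

theorem algebra_mul {A : C} [MonObj A] (s t : 𝟙_ C ⟶ 𝟙_ C) :
    (t ≫ s) ≫ η[A] = lact (s ≫ η[A]) (t ≫ η[A]) := by
  rw [lact_comp, lact_one, Category.assoc]

/-- The `Z(𝟙)`-algebra structure of `Z(A)`, with structure map `t ↦ u ∘ t`. -/
instance (A : C) [MonObj A] : Algebra (End (𝟙_ C)) (Z A) where
  smul t s := Z.of (End.asHom t ≫ s.hom)
  algebraMap :=
    { toFun := fun t => Z.of (End.asHom t ≫ η[A])
      map_one' := Category.id_comp _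
      map_mul' := fun s t => algebra_mul s.asHom t.asHom
      map_zero' := zero_comp
      map_add' := fun s t => Preadditive.add_comp _ _ _ s.asHom t.asHom _ }
  commutes' := fun t s => algebra_comm t.asHom s.hom
  smul_def' := fun t s => algebra_smul t.asHom s.hom

theorem algebraMap_hom {A : C} [MonObj A] (t : End (𝟙_ C)) :
    (algebraMap (End (𝟙_ C)) (Z A) t).hom = t.asHom ≫ η[A] := rfl

end Invariants

/-! ### Two-sided invertible subobjects -/

section Invertible

variable {A : C} [MonObj A]

/-- The subobjects `X` and `Y` of `A` are two-sided inverse to each other: the products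
`m ∘ (i_X ⊗ i_Y)` and `m ∘ (i_Y ⊗ i_X)` factor through the unit of `A` by isomorphisms
`m_X : X ⊗ Y ⟶ 𝟙` and `m_Y : Y ⊗ X ⟶ 𝟙`. -/
def IsTwoSidedInverse (X Y : Subobject A) : Prop :=
  ∃ (mX : (X : C) ⊗ (Y : C) ⟶ 𝟙_ C) (mY : (Y : C) ⊗ (X : C) ⟶ 𝟙_ C),
    IsIso mX ∧ IsIso mY ∧
    mX ≫ η[A] = (X.arrow ⊗ₘ Y.arrow) ≫ μ[A] ∧
    mY ≫ η[A] = (Y.arrow ⊗ₘ X.arrow) ≫ μ[A]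

variable (A) in
/-- `Inv_𝟙(A)`, the set of two-sided invertible subobjects of `A`. -/
@[ext]
structure Inv where
  /-- The underlying subobject. -/
  sub : Subobject A
  exists_inverse : ∃ Y : Subobject A, IsTwoSidedInverse sub Y

/-- Isomorphism of objects over `A`. -/
def OverIso {X Y : C} (f : X ⟶ A) (g : Y ⟶ A) : Prop := ∃ e : X ≅ Y, e.hom ≫ g = f

theorem OverIso.refl {X : C} (f : X ⟶ A) : OverIso f f := ⟨Iso.refl _, by simp⟩

theorem OverIso.symm {X Y : C} {f : X ⟶ A} {g : Y ⟶ A} (h : OverIso f g) : OverIso g f := by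
  obtain ⟨e, he⟩ := h
  exact ⟨e.symm, by simp [← he]⟩

theorem OverIso.trans {X Y W : C} {f : X ⟶ A} {g : Y ⟶ A} {h : W ⟶ A} (h₁ : OverIso f g)
    (h₂ : OverIso g h) : OverIso f h := by
  obtain ⟨e, he⟩ := h₁
  obtain ⟨e', he'⟩ := h₂
  exact ⟨e ≪≫ e', by simp [he', he]⟩

theorem OverIso.star {X Y X' Y' : C} {f : X ⟶ A} {f' : X' ⟶ A} {g : Y ⟶ A} {g' : Y' ⟶ A}
    (h₁ : OverIso f f') (h₂ : OverIso g g') : OverIso (star f g) (star f' g') := by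
  obtain ⟨e, he⟩ := h₁
  obtain ⟨e', he'⟩ := h₂
  exact ⟨e ⊗ᵢ e', by simp [tensor_star, he, he']⟩

theorem overIso_assoc {X Y W : C} (f : X ⟶ A) (g : Y ⟶ A) (h : W ⟶ A) :
    OverIso (Miyashita.star (Miyashita.star f g) h) (Miyashita.star f (Miyashita.star g h)) :=
  ⟨α_ X Y W, (star_assoc f g h).symm⟩

theorem overIso_one_star {X : C} (f : X ⟶ A) : OverIso (Miyashita.star η[A] f) f :=
  ⟨λ_ X, (one_star f).symm⟩

theorem overIso_star_one {X : C} (f : X ⟶ A) : OverIso (Miyashita.star f η[A]) f :=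
  ⟨ρ_ X, (star_one f).symm⟩

theorem overIso_mk {X : C} (f : X ⟶ A) [Mono f] : OverIso (Subobject.mk f).arrow f :=
  ⟨Subobject.underlyingIso f, by simp⟩

theorem eq_of_overIso {P Q : Subobject A} (h : OverIso P.arrow Q.arrow) : P = Q := by
  obtain ⟨e, he⟩ := h
  exact Subobject.eq_of_comm e he

theorem isTwoSidedInverse_iff {X Y : Subobject A} : IsTwoSidedInverse X Y ↔
    OverIso (Miyashita.star X.arrow Y.arrow) η[A] ∧
      OverIso (Miyashita.star Y.arrow X.arrow) η[A] := by
  constructor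
  · rintro ⟨a, b, ha, hb, h1, h2⟩
    exact ⟨⟨asIso a, h1⟩, ⟨asIso b, h2⟩⟩
  · rintro ⟨⟨a, h1⟩, ⟨b, h2⟩⟩
    exact ⟨a.hom, b.hom, inferInstance, inferInstance, h1, h2⟩

theorem IsTwoSidedInverse.symm {X Y : Subobject A} (h : IsTwoSidedInverse X Y) :
    IsTwoSidedInverse Y X := by
  obtain ⟨a, b, ha, hb, h1, h2⟩ := h
  exact ⟨b, a, hb, ha, h2, h1⟩

theorem isEquivalence_tensorLeft {X Y : C} (a : X ⊗ Y ≅ 𝟙_ C) (b : Y ⊗ X ≅ 𝟙_ C) :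
    (tensorLeft X).IsEquivalence :=
  (CategoryTheory.Equivalence.mk (tensorLeft X) (tensorLeft Y)
    ((leftUnitorNatIso C).symm ≪≫ (curriedTensor C).mapIso b.symm ≪≫ tensorLeftTensor Y X)
    ((tensorLeftTensor X Y).symm ≪≫ (curriedTensor C).mapIso a ≪≫
      leftUnitorNatIso C)).isEquivalence_functor

theorem isEquivalence_tensorRight {X Y : C} (a : X ⊗ Y ≅ 𝟙_ C) (b : Y ⊗ X ≅ 𝟙_ C) :
    (tensorRight X).IsEquivalence :=
  (CategoryTheory.Equivalence.mk (tensorRight X) (tensorRight Y)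
    ((rightUnitorNatIso C).symm ≪≫ (curriedTensor C).flip.mapIso a.symm ≪≫ tensorRightTensor X Y)
    ((tensorRightTensor Y X).symm ≪≫ (curriedTensor C).flip.mapIso b ≪≫
      rightUnitorNatIso C)).isEquivalence_functor

/-- Left multiplication by an invertible subobject is an isomorphism `X ⊗ A ≅ A`. -/
theorem IsTwoSidedInverse.isIso_left {X Y : Subobject A} (h : IsTwoSidedInverse X Y) :
    IsIso (Miyashita.star X.arrow (𝟙 A)) := by
  have key : ∀ P Q : Subobject A, IsTwoSidedInverse P Q →
      IsIso ((P : C) ◁ Miyashita.star Q.arrow (𝟙 A) ≫ Miyashita.star P.arrow (𝟙 A)) := by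
    rintro P Q ⟨a, b, ha, hb, h1, h2⟩
    have e : (P : C) ◁ Miyashita.star Q.arrow (𝟙 A) ≫ Miyashita.star P.arrow (𝟙 A) =
        (α_ _ _ _).inv ≫ a ▷ A ≫ (λ_ A).hom := by
      rw [← star_comp_right, Category.comp_id, Iso.eq_inv_comp, ← star_assoc, star,
        star, ← h1, ← star, star_comp_left, one_star, Category.comp_id]
    rw [e]
    infer_instance
  have k1 := key X Y h
  have k2 := key Y X h.symm
  have hm : Mono (Miyashita.star X.arrow (𝟙 A)) := by
    obtain ⟨a, b, ha, hb, -, -⟩ := h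
    have := isEquivalence_tensorLeft (asIso b) (asIso a)
    have hm' : Mono ((tensorLeft (Y : C)).map (Miyashita.star X.arrow (𝟙 A))) :=
      mono_of_mono ((Y : C) ◁ Miyashita.star X.arrow (𝟙 A)) (Miyashita.star Y.arrow (𝟙 A))
    exact (tensorLeft (Y : C)).mono_of_mono_map hm'
  have : IsSplitEpi (Miyashita.star X.arrow (𝟙 A)) :=
    IsSplitEpi.mk' ⟨inv ((X : C) ◁ Miyashita.star Y.arrow (𝟙 A) ≫ Miyashita.star X.arrow (𝟙 A)) ≫
      (X : C) ◁ Miyashita.star Y.arrow (𝟙 A), by simp⟩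
  exact isIso_of_mono_of_isSplitEpi _

theorem IsTwoSidedInverse.mono_right {X Y : Subobject A} (h : IsTwoSidedInverse X Y) :
    Mono (Miyashita.star (𝟙 A) X.arrow) := by
  obtain ⟨a, b, ha, hb, h1, h2⟩ := h
  have := isEquivalence_tensorRight (asIso b) (asIso a)
  have e : Miyashita.star (𝟙 A) X.arrow ▷ (Y : C) ≫ Miyashita.star (𝟙 A) Y.arrow =
      (α_ _ _ _).hom ≫ A ◁ a ≫ (ρ_ A).hom := by
    rw [← star_comp_left, Category.comp_id, star_assoc]
    rw [star, star, ← h1, ← star, star_comp_right, star_one, Category.comp_id]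
  have hm' : Mono ((tensorRight (Y : C)).map (Miyashita.star (𝟙 A) X.arrow)) := by
    have : Mono (Miyashita.star (𝟙 A) X.arrow ▷ (Y : C) ≫ Miyashita.star (𝟙 A) Y.arrow) := by
      rw [e]
      infer_instance
    exact mono_of_mono (Miyashita.star (𝟙 A) X.arrow ▷ (Y : C)) (Miyashita.star (𝟙 A) Y.arrow)
  exact (tensorRight (Y : C)).mono_of_mono_map hm'

theorem Inv.mono_mul (X Y : Inv A) : Mono ((X.sub.arrow ⊗ₘ Y.sub.arrow) ≫ μ[A]) := by
  obtain ⟨X', hX⟩ := X.exists_inverse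
  have := hX.isIso_left
  obtain ⟨a, b, ha, hb, -, -⟩ := hX
  have := isEquivalence_tensorLeft (asIso a) (asIso b)
  have : Mono ((X.sub : C) ◁ Y.sub.arrow) :=
    inferInstanceAs (Mono ((tensorLeft (X.sub : C)).map Y.sub.arrow))
  have e : (X.sub.arrow ⊗ₘ Y.sub.arrow) ≫ μ[A] =
      (X.sub : C) ◁ Y.sub.arrow ≫ Miyashita.star X.sub.arrow (𝟙 A) := by
    rw [← star_comp_right, Category.comp_id, star]
  rw [e]
  infer_instance

/-- The product of two invertible subobjects is `X ⊗ X'` with monomorphism `m ∘ (i_X ⊗ i_X')`. -/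
def Inv.mulSubobject (X X' : Inv A) : Subobject A :=
  have := X.mono_mul X'
  Subobject.mk ((X.sub.arrow ⊗ₘ X'.sub.arrow) ≫ μ[A])

theorem Inv.mulSubobject_overIso (X X' : Inv A) :
    OverIso (X.mulSubobject X').arrow (Miyashita.star X.sub.arrow X'.sub.arrow) :=
  have := X.mono_mul X'
  overIso_mk ((X.sub.arrow ⊗ₘ X'.sub.arrow) ≫ μ[A])

theorem overIso_inverse {X Y X' Y' P Q : C} {f : X ⟶ A} {g : Y ⟶ A} {f' : X' ⟶ A} {g' : Y' ⟶ A}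
    {p : P ⟶ A} {q : Q ⟶ A}
    (h : OverIso (Miyashita.star f g) η[A]) (h' : OverIso (Miyashita.star f' g') η[A])
    (hp : OverIso p (Miyashita.star f f')) (hq : OverIso q (Miyashita.star g' g)) :
    OverIso (Miyashita.star p q) η[A] := by
  refine (hp.star hq).trans ((overIso_assoc _ _ _).trans ?_)
  refine ((OverIso.refl f).star ((overIso_assoc f' g' g).symm.trans
    ((h'.star (OverIso.refl g)).trans (overIso_one_star g)))).trans h

theorem IsTwoSidedInverse.mul {X Y X' Y' : Inv A} (h : IsTwoSidedInverse X.sub Y.sub)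
    (h' : IsTwoSidedInverse X'.sub Y'.sub) :
    IsTwoSidedInverse (X.mulSubobject X') (Y'.mulSubobject Y) := by
  rw [isTwoSidedInverse_iff] at h h' ⊢
  exact ⟨overIso_inverse h.1 h'.1 (X.mulSubobject_overIso X') (Y'.mulSubobject_overIso Y),
    overIso_inverse h'.2 h.2 (Y'.mulSubobject_overIso Y) (X.mulSubobject_overIso X')⟩

/-- A two-sided inverse of an invertible subobject. -/
def Inv.inverse (X : Inv A) : Inv A := ⟨X.exists_inverse.choose, X.sub, X.exists_inverse.choose_spec.symm⟩

theorem Inv.isTwoSidedInverse (X : Inv A) : IsTwoSidedInverse X.sub X.inverse.1 := X.exists_inverse.choose_spec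

variable (A) in
theorem isTwoSidedInverse_unit [Mono η[A]] :
    IsTwoSidedInverse (Subobject.mk η[A]) (Subobject.mk η[A]) := by
  rw [isTwoSidedInverse_iff]
  have h : OverIso (Miyashita.star (Subobject.mk η[A]).arrow (Subobject.mk η[A]).arrow) η[A] :=
    ((overIso_mk η[A]).star (overIso_mk η[A])).trans (overIso_one_star η[A])
  exact ⟨h, h⟩

/-- The group `Inv_𝟙(A)`: the product of `X` and `X'` is `X ⊗ X'` and the neutral element is the
unit `u : 𝟙 ⟶ A`, which has to be a monomorphism. -/
instance [Mono η[A]] : Group (Inv A) :=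
  { mul := fun X X' => ⟨X.mulSubobject X', _, X.isTwoSidedInverse.mul X'.isTwoSidedInverse⟩
    one := ⟨Subobject.mk η[A], _, isTwoSidedInverse_unit A⟩
    inv := Inv.inverse
    mul_assoc := fun X Y W => Inv.ext <| eq_of_overIso <|
      (Inv.mulSubobject_overIso _ W).trans <|
        ((X.mulSubobject_overIso Y).star (OverIso.refl _)).trans <|
          (overIso_assoc _ _ _).trans <|
            ((OverIso.refl _).star (Y.mulSubobject_overIso W).symm).trans
              (Inv.mulSubobject_overIso X ⟨_, _, Y.isTwoSidedInverse.mul W.isTwoSidedInverse⟩).symm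
    one_mul := fun X => Inv.ext <| eq_of_overIso <|
      (Inv.mulSubobject_overIso _ X).trans <|
        ((overIso_mk η[A]).star (OverIso.refl _)).trans (overIso_one_star _)
    mul_one := fun X => Inv.ext <| eq_of_overIso <|
      (Inv.mulSubobject_overIso X _).trans <|
        ((OverIso.refl _).star (overIso_mk η[A])).trans (overIso_star_one _)
    inv_mul_cancel := fun X => Inv.ext <| eq_of_overIso <|
      (Inv.mulSubobject_overIso _ X).trans <|
        (isTwoSidedInverse_iff.mp X.isTwoSidedInverse).2.trans (overIso_mk η[A]).symm }

end Invertible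

/-! ### The Miyashita action -/

section Action

variable {A : C} [MonObj A]

/-- `m ∘ (i_X ⊗ (t ▷ i_Y)) ∘ m_X⁻¹ : 𝟙 ⟶ A`, where `m_X : X ⊗ Y ≅ 𝟙`. -/
def phi (X Y : Subobject A) (mX : (X : C) ⊗ (Y : C) ⟶ 𝟙_ C) [IsIso mX] (t : 𝟙_ C ⟶ A) :
    𝟙_ C ⟶ A :=
  inv mX ≫ (X.arrow ⊗ₘ lact t Y.arrow) ≫ μ[A]

theorem phi_lact {X Y : Subobject A} (h : IsTwoSidedInverse X Y)
    (mX : (X : C) ⊗ (Y : C) ⟶ 𝟙_ C) [IsIso mX]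
    (hmX : mX ≫ η[A] = (X.arrow ⊗ₘ Y.arrow) ≫ μ[A]) (t : 𝟙_ C ⟶ A) :
    lact (phi X Y mX t) X.arrow = ract X.arrow t := by
  obtain ⟨-, mY, -, -, -, hmY⟩ := h
  have hY : star Y.arrow X.arrow = mY ≫ η[A] := hmY.symm
  have hX : star X.arrow Y.arrow = mX ≫ η[A] := hmX.symm
  have e : star (lact t Y.arrow) X.arrow = star Y.arrow (ract X.arrow t) := by
    rw [← lact_star, ← star_ract, hY, lact_comp, ract_comp, lact_one, one_ract]
  have e' : phi X Y mX t = inv mX ≫ star X.arrow (lact t Y.arrow) := rfl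
  rw [lact_eq, e', star_comp_left, star_assoc, e, ← star_assoc, hX, ← star_comp_left,
    IsIso.inv_hom_id_assoc, one_star, Iso.inv_hom_id_assoc]

theorem lact_injective {X Y : Subobject A} (h : IsTwoSidedInverse X Y) {s t : 𝟙_ C ⟶ A}
    (hst : lact s X.arrow = lact t X.arrow) : s = t := by
  have := h.mono_right
  have e : ∀ r : 𝟙_ C ⟶ A, lact r X.arrow = (λ_ _).inv ≫ r ▷ (X : C) ≫ star (𝟙 A) X.arrow := by
    intro r
    rw [lact_eq, ← star_comp_left, Category.comp_id]
  rw [e, e, cancel_epi, cancel_mono] at hst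
  obtain ⟨a, b, ha, hb, -, -⟩ := h
  have := isEquivalence_tensorRight (asIso a) (asIso b)
  exact (tensorRight (X : C)).map_injective hst

theorem ract_bijective {X Y : Subobject A} (h : IsTwoSidedInverse X Y) :
    Function.Bijective (fun t : 𝟙_ C ⟶ A => ract X.arrow t) := by
  have := h.isIso_left
  have e : ∀ r : 𝟙_ C ⟶ A, ract X.arrow r = (ρ_ _).inv ≫ (X : C) ◁ r ≫ star X.arrow (𝟙 A) := by
    intro r
    rw [ract_eq, ← star_comp_right, Category.comp_id]
  obtain ⟨a, b, ha, hb, -, -⟩ := h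
  have := isEquivalence_tensorLeft (asIso a) (asIso b)
  constructor
  · intro s t hst
    dsimp only at hst
    rw [e, e, cancel_epi, cancel_mono] at hst
    exact (tensorLeft (X : C)).map_injective hst
  · intro f
    obtain ⟨r, hr⟩ := (tensorLeft (X : C)).map_surjective
      ((ρ_ (X : C)).hom ≫ f ≫ inv (star X.arrow (𝟙 A)))
    refine ⟨r, ?_⟩
    dsimp only
    rw [e]
    change _ ≫ (tensorLeft (X : C)).map r ≫ _ = _
    rw [hr]
    simp

variable [Preadditive C] [MonoidalPreadditive C] [Penrose C]

/-- The isomorphism `m_X : X ⊗ X⁻¹ ⟶ 𝟙`. -/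
def Inv.counit (X : Inv A) : (X.sub : C) ⊗ (X.inverse.1 : C) ⟶ 𝟙_ C := X.isTwoSidedInverse.choose

instance (X : Inv A) : IsIso X.counit := X.isTwoSidedInverse.choose_spec.choose_spec.1

theorem Inv.counit_unit (X : Inv A) :
    X.counit ≫ η[A] = (X.sub.arrow ⊗ₘ X.inverse.1.arrow) ≫ μ[A] :=
  X.isTwoSidedInverse.choose_spec.choose_spec.2.2.1

/-- The map `Φ_X : Z(A) → Z(A)`. -/
def Inv.phiMap (X : Inv A) (t : Z A) : Z A := Z.of (phi X.sub X.inverse.1 X.counit t.hom)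

theorem Inv.phiMap_lact (X : Inv A) (t : Z A) :
    lact (X.phiMap t).hom X.sub.arrow = ract X.sub.arrow t.hom :=
  phi_lact X.isTwoSidedInverse X.counit X.counit_unit t.hom

theorem Inv.phiMap_eq (X : Inv A) {s t : Z A} (h : lact s.hom X.sub.arrow = ract X.sub.arrow t.hom) :
    X.phiMap t = s :=
  Z.hom_injective (lact_injective X.isTwoSidedInverse ((X.phiMap_lact t).trans h.symm))

/-- The Miyashita action `Φ : Inv_𝟙(A) → Aut(Z(A))`, with values in the `Z(𝟙)`-algebra
automorphisms of `Z(A)`. -/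
def miyashitaAction (X : Inv A) : Z A ≃ₐ[End (𝟙_ C)] Z A :=
  AlgEquiv.ofBijective
    { toFun := X.phiMap
      map_one' := X.phiMap_eq ((one_lact _).trans (ract_one _).symm)
      map_mul' := fun s t => X.phiMap_eq <| by
        rw [Z.mul_hom, Z.mul_hom, lact_lact, X.phiMap_lact, ← lact_ract, X.phiMap_lact,
          ract_ract, lact_eq_ract]
      map_zero' := X.phiMap_eq <| by
        have e := ract_add X.sub.arrow 0 0
        rw [add_zero] at e
        exact (zero_lact _).trans (left_eq_add.mp e).symm
      map_add' := fun s t => X.phiMap_eq <| by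
        rw [Z.add_hom, Z.add_hom, add_lact, ract_add, X.phiMap_lact, X.phiMap_lact]
      commutes' := fun t => X.phiMap_eq (scalar_lact _ _) }
    ⟨fun s t hst => (ract_bijective X.isTwoSidedInverse).1 <| by
        have h : X.phiMap s = X.phiMap t := hst
        exact (X.phiMap_lact s).symm.trans ((congrArg (fun r : Z A => lact r.hom X.sub.arrow) h).trans
          (X.phiMap_lact t)),
      fun s => by
        obtain ⟨t, ht⟩ := (ract_bijective X.isTwoSidedInverse).2 (lact s.hom X.sub.arrow)
        exact ⟨Z.of t, X.phiMap_eq (t := Z.of t) ht.symm⟩⟩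

/-- The Miyashita action is given by the formula `Φ_X(t) = m ∘ (i_X ⊗ (t ▷ i_Y)) ∘ m_X⁻¹` for every
two-sided inverse `Y` of `X`. -/
theorem miyashitaAction_apply (X : Inv A) (Y : Subobject A) (h : IsTwoSidedInverse X.sub Y)
    (mX : (X.sub : C) ⊗ (Y : C) ⟶ 𝟙_ C) [IsIso mX]
    (hmX : mX ≫ η[A] = (X.sub.arrow ⊗ₘ Y.arrow) ≫ μ[A]) (t : Z A) :
    (miyashitaAction X t).hom =
      inv mX ≫ (X.sub.arrow ⊗ₘ ((λ_ (Y : C)).inv ≫ (t.hom ⊗ₘ Y.arrow) ≫ μ[A])) ≫ μ[A] :=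
  X.phiMap_eq (s := Z.of (phi X.sub Y mX t.hom)) (phi_lact h mX hmX t.hom)

end Action

/-! ### Invariant subobjects -/

section InvariantSubobjects

variable [Abelian C] [MonoidalPreadditive C] [HasLimits C] [WellPowered.{v} C]
variable {A : C} [MonObj A]

/-- The invariant subobject `_σJ_δ` of `A`: the intersection over all `t : Z(A)` of the equalizers
of `σ(t) ▷ A` and `A ◁ δ(t)`. -/
def J (σ δ : Z A →ₗ[End (𝟙_ C)] Z A) : Subobject A :=
  Subobject.sInf.{v, v, u} (Set.range fun t : Z A =>
    equalizerSubobject (lact (σ t).hom (𝟙 A)) (ract (𝟙 A) (δ t).hom))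

theorem J_factors_iff (σ δ : Z A →ₗ[End (𝟙_ C)] Z A) {X : C} (f : X ⟶ A) :
    (J σ δ).Factors f ↔ ∀ t : Z A, lact (σ t).hom f = ract f (δ t).hom := by
  have e : ∀ t : Z A, (equalizerSubobject (lact (σ t).hom (𝟙 A)) (ract (𝟙 A) (δ t).hom)).Factors f ↔
      lact (σ t).hom f = ract f (δ t).hom := by
    intro t
    rw [equalizerSubobject_factors_iff, ← lact_comp, ← ract_comp, Category.comp_id]
  constructor
  · intro h t
    exact (e t).mp (Subobject.factors_of_le f (Subobject.sInf_le.{v, v, u} _ _ (Set.mem_range_self t)) h)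
  · intro h
    have hle : imageSubobject f ≤ J σ δ := by
      refine Subobject.le_sInf.{v, v, u} _ _ ?_
      rintro _ ⟨t, rfl⟩
      have ht := (e t).mpr (h t)
      exact imageSubobject_le f (Subobject.factorThru _ f ht) (Subobject.factorThru_arrow _ f ht)
    refine Subobject.factors_of_le f hle ?_
    simpa using imageSubobject_factors_comp_self f (𝟙 X)

theorem J_arrow (σ δ : Z A →ₗ[End (𝟙_ C)] Z A) (t : Z A) :
    lact (σ t).hom (J σ δ).arrow = ract (J σ δ).arrow (δ t).hom :=
  (J_factors_iff σ δ _).mp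
    ((Subobject.factors_iff _ _).mpr ⟨𝟙 _, Category.id_comp _⟩) t

theorem J_mul_factors (σ δ τ : Z A →ₗ[End (𝟙_ C)] Z A) :
    (J σ τ).Factors (((J σ δ).arrow ⊗ₘ (J δ τ).arrow) ≫ μ[A]) :=
  (J_factors_iff σ τ _).mpr fun t => by
    change lact _ (star _ _) = ract (star _ _) _
    rw [lact_star, J_arrow, ract_star, J_arrow, star_ract]

theorem J_unit_factors (σ : Z A →ₗ[End (𝟙_ C)] Z A) : (J σ σ).Factors η[A] :=
  (J_factors_iff σ σ _).mpr fun t => by rw [lact_one, one_ract]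

/-- The morphism `m_{σ,τ}^δ : _σJ_δ ⊗ _δJ_τ ⟶ _σJ_τ` induced by the multiplication of `A`. -/
def mJ (σ δ τ : Z A →ₗ[End (𝟙_ C)] Z A) :
    (J σ δ : C) ⊗ (J δ τ : C) ⟶ (J σ τ : C) :=
  (J σ τ).factorThru _ (J_mul_factors σ δ τ)

/-- The morphism `u_σ : 𝟙 ⟶ _σJ_σ` induced by the unit of `A`. -/
def uJ (σ : Z A →ₗ[End (𝟙_ C)] Z A) : 𝟙_ C ⟶ (J σ σ : C) :=
  (J σ σ).factorThru η[A] (J_unit_factors σ)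

theorem mJ_arrow (σ δ τ : Z A →ₗ[End (𝟙_ C)] Z A) :
    mJ σ δ τ ≫ (J σ τ).arrow = star (J σ δ).arrow (J δ τ).arrow :=
  Subobject.factorThru_arrow _ _ _

theorem uJ_arrow (σ : Z A →ₗ[End (𝟙_ C)] Z A) : uJ σ ≫ (J σ σ).arrow = η[A] :=
  Subobject.factorThru_arrow _ _ _

theorem mJ_assoc (σ δ τ κ : Z A →ₗ[End (𝟙_ C)] Z A) :
    mJ σ δ τ ▷ (J τ κ : C) ≫ mJ σ τ κ =
      (α_ _ _ _).hom ≫ (J σ δ : C) ◁ mJ δ τ κ ≫ mJ σ δ κ := by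
  rw [← cancel_mono (J σ κ).arrow]
  simp only [Category.assoc, mJ_arrow]
  rw [← star_comp_left, ← star_comp_right, mJ_arrow, mJ_arrow, star_assoc]

/-- The monoid `(_σJ_σ, m_σ, u_σ)`. -/
instance instMonObjJ (σ : Z A →ₗ[End (𝟙_ C)] Z A) : MonObj (J σ σ : C) where
  one := uJ σ
  mul := mJ σ σ σ
  one_mul := by
    rw [← cancel_mono (J σ σ).arrow, Category.assoc, mJ_arrow, ← star_comp_left, uJ_arrow,
      one_star]
  mul_one := by
    rw [← cancel_mono (J σ σ).arrow, Category.assoc, mJ_arrow, ← star_comp_right, uJ_arrow,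
      star_one]
  mul_assoc := mJ_assoc σ σ σ σ

/-- The tensor product `X ⊗_R Y` over a monoid `R` of a right `R`-module `X` with action `r` and a
left `R`-module `Y` with action `l`. -/
def tensorOver (R : C) [MonObj R] {X Y : C} (r : X ⊗ R ⟶ X) (l : R ⊗ Y ⟶ Y) : C :=
  coequalizer (r ▷ Y) ((α_ X R Y).hom ≫ X ◁ l)

/-- The morphism `_σJ_δ ⊗_{_δJ_δ} _δJ_τ ⟶ _σJ_τ` induced by `m_{σ,τ}^δ`. -/
def mJbar (σ δ τ : Z A →ₗ[End (𝟙_ C)] Z A) :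
    tensorOver (J δ δ : C) (mJ σ δ δ) (mJ δ δ τ) ⟶ (J σ τ : C) :=
  coequalizer.desc (mJ σ δ τ) (by rw [Category.assoc]; exact mJ_assoc σ δ δ τ)

variable (A) in
/-- The set `G(Z(A))` of the `Z(𝟙)`-algebra automorphisms `θ` of `Z(A)` for which `_θJ_1` is
two-sided invertible with inverse `_1J_θ`, that is, for which the multiplications
`_θJ_1 ⊗_{_1J_1} _1J_θ ⟶ _θJ_θ` and `_1J_θ ⊗_{_θJ_θ} _θJ_1 ⟶ _1J_1` are isomorphisms. -/
def GSet : Set (Z A ≃ₐ[End (𝟙_ C)] Z A) :=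
  {θ | IsIso (mJbar θ.toLinearMap LinearMap.id θ.toLinearMap) ∧
    IsIso (mJbar LinearMap.id θ.toLinearMap (LinearMap.id : Z A →ₗ[End (𝟙_ C)] Z A))}

variable (A) in
/-- The unit `u_1 : 𝟙 ⟶ _1J_1`. -/
abbrev u₁ : 𝟙_ C ⟶ (J (LinearMap.id : Z A →ₗ[End (𝟙_ C)] Z A) LinearMap.id : C) :=
  uJ LinearMap.id

variable (A) in
instance mono_unit [IsIso (u₁ A)] : Mono η[A] := by
  rw [← uJ_arrow (LinearMap.id : Z A →ₗ[End (𝟙_ C)] Z A)]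
  exact mono_comp (u₁ A) _

end InvariantSubobjects

end Miyashita

end

/-! The whole argument rests on one identity: `Φ_X(t) ▷ i_X = i_X ◁ t`, where `Φ_X(t)` is the only
element of `Z(A)` with this property because multiplication by an invertible `X` is cancellable.
Multiplicativity of `Φ` follows by moving `t` past `i_Y` and then past `i_X`
(`miyashitaAction_mul`).

The identity is also the condition cutting out `_θJ_1` for `θ = Φ_X`, so `X ⊆ _θJ_1`; applied to the
inverse `Y` of `X` it gives `Y ⊆ _1J_θ`. Conversely, `Y · _θJ_1 ⊆ _1J_θ · _θJ_1 ⊆ _1J_1 = 𝟙`, and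
multiplying by `X` yields `_θJ_1 ⊆ X`. Hence `X = _θJ_1` (`J_miyashitaAction_left`), likewise `Y =
_1J_θ`, and `Φ` is injective.

For any automorphism `θ` one has `_θJ_θ = _1J_1 = 𝟙`, so the relative tensor products in the
definition of `G(Z(A))` are tensor products over the unit. Therefore `θ` lies in `G(Z(A))` exactly
when `_θJ_1` and `_1J_θ` are mutually inverse (`mem_GSet_iff`). In that case the identity defining
`_θJ_1` forces its Miyashita automorphism to be `θ`. So `G(Z(A))` is the range of an injective
homomorphism. -/

namespace Miyashita

noncomputable section

/-! ### Bounding a subobject by an invertible one -/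

section Invertible

variable {C : Type u} [Category.{v} C] [MonoidalCategory C] {A : C} [MonObj A]

/-- From `Y · P ⊆ 𝟙` one gets `P = X · Y · P ⊆ X`: the comparison map is `P ≅ 𝟙 ⊗ P ≅ (X ⊗ Y) ⊗ P ≅
X ⊗ (Y ⊗ P) ⟶ X ⊗ 𝟙 ≅ X`. The next lemma is the mirror image. -/
theorem le_of_factors_star {X Y P : Subobject A} (h : IsTwoSidedInverse X Y)
    (k : (Y : C) ⊗ (P : C) ⟶ 𝟙_ C) (hk : k ≫ η[A] = star Y.arrow P.arrow) : P ≤ X := by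
  obtain ⟨a, -, ha, -, h1, -⟩ := h
  refine Subobject.le_of_comm
    ((λ_ (P : C)).inv ≫ inv a ▷ (P : C) ≫ (α_ _ _ _).hom ≫ (X : C) ◁ k ≫ (ρ_ _).hom) ?_
  have h1' : star X.arrow Y.arrow = a ≫ η[A] := h1.symm
  simp only [Category.assoc]
  rw [← star_one, ← star_comp_right, hk, ← star_assoc, ← star_comp_left, h1',
    IsIso.inv_hom_id_assoc, one_star, Iso.inv_hom_id_assoc]

theorem le_of_star_factors {X Y P : Subobject A} (h : IsTwoSidedInverse X Y)
    (k : (P : C) ⊗ (Y : C) ⟶ 𝟙_ C) (hk : k ≫ η[A] = star P.arrow Y.arrow) : P ≤ X := by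
  obtain ⟨-, b, -, hb, -, h2⟩ := h
  refine Subobject.le_of_comm
    ((ρ_ (P : C)).inv ≫ (P : C) ◁ inv b ≫ (α_ _ _ _).inv ≫ k ▷ (X : C) ≫ (λ_ _).hom) ?_
  have h2' : star Y.arrow X.arrow = b ≫ η[A] := h2.symm
  simp only [Category.assoc]
  rw [← one_star, ← star_comp_left, hk, star_assoc, Iso.inv_hom_id_assoc, ← star_comp_right, h2',
    IsIso.inv_hom_id_assoc, star_one, Iso.inv_hom_id_assoc]

end Invertible

/-! ### The Miyashita action is a group homomorphism -/

section Multiplicativity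

variable {C : Type u} [Category.{v} C] [MonoidalCategory C] [Preadditive C]
  [MonoidalPreadditive C] [Penrose C] {A : C} [MonObj A]

theorem miyashitaAction_lact (X : Inv A) (t : Z A) :
    lact (miyashitaAction X t).hom X.sub.arrow = ract X.sub.arrow t.hom :=
  X.phiMap_lact t

theorem miyashitaAction_mul [Mono η[A]] (X Y : Inv A) :
    miyashitaAction (X * Y) = miyashitaAction X * miyashitaAction Y := by
  ext t
  -- By uniqueness it suffices that `Φ_X(Φ_Y(t))` satisfies the characterizing identity for `X * Y`,
  -- which may be checked on `m ∘ (i_X ⊗ i_Y)`.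
  refine (X * Y).phiMap_eq ?_
  obtain ⟨e, he⟩ := X.mulSubobject_overIso Y
  change lact _ (X.mulSubobject Y).arrow = ract (X.mulSubobject Y).arrow _
  rw [← he, lact_comp, ract_comp, lact_star, AlgEquiv.mul_apply, miyashitaAction_lact, ract_star,
    miyashitaAction_lact, star_ract]

variable (A) in
/-- The Miyashita action as a homomorphism of groups. -/
def miyashitaHom [Mono η[A]] : Inv A →* (Z A ≃ₐ[End (𝟙_ C)] Z A) :=
  MonoidHom.mk' miyashitaAction miyashitaAction_mul

end Multiplicativity

/-! ### Invariant subobjects and the description of `G(Z(A))` -/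

section InvariantSubobjects

variable {C : Type u} [Category.{v} C] [MonoidalCategory C] [Abelian C] [MonoidalPreadditive C]
  [HasLimits C] [WellPowered.{v} C] {A : C} [MonObj A]

theorem le_J_iff (σ δ : Z A →ₗ[End (𝟙_ C)] Z A) (P : Subobject A) :
    P ≤ J σ δ ↔ ∀ t : Z A, lact (σ t).hom P.arrow = ract P.arrow (δ t).hom := by
  rw [← J_factors_iff]
  exact ⟨fun h => (Subobject.factors_iff _ _).mpr ⟨Subobject.ofLE _ _ h, Subobject.ofLE_arrow h⟩,
    fun h => Subobject.le_of_comm ((J σ δ).factorThru _ h) (Subobject.factorThru_arrow _ _ h)⟩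

/-- Since `θ` is surjective, `θ(t)` and `t` run through the same elements, so both sides impose the
same conditions. -/
theorem J_algEquiv_self (θ : Z A ≃ₐ[End (𝟙_ C)] Z A) :
    J θ.toLinearMap θ.toLinearMap = J LinearMap.id LinearMap.id := by
  refine le_antisymm ((le_J_iff _ _ _).mpr fun t => ?_) ((le_J_iff _ _ _).mpr fun t => ?_)
  · have h := J_arrow θ.toLinearMap θ.toLinearMap (θ.symm t)
    rwa [AlgEquiv.toLinearMap_apply, AlgEquiv.apply_symm_apply] at h
  · exact J_arrow LinearMap.id LinearMap.id (θ t)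

theorem overIso_J_self [IsIso (u₁ A)] (θ : Z A ≃ₐ[End (𝟙_ C)] Z A) :
    OverIso (J θ.toLinearMap θ.toLinearMap).arrow η[A] := by
  rw [J_algEquiv_self]
  exact OverIso.symm ⟨asIso (u₁ A), uJ_arrow _⟩

theorem isIso_uJ [IsIso (u₁ A)] (θ : Z A ≃ₐ[End (𝟙_ C)] Z A) : IsIso (uJ θ.toLinearMap) := by
  obtain ⟨e, he⟩ := (overIso_J_self θ).symm
  have : uJ θ.toLinearMap = e.hom := by
    rw [← cancel_mono (J θ.toLinearMap θ.toLinearMap).arrow, uJ_arrow, he]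
  rw [this]
  infer_instance

/-- When `_δJ_δ` is the unit object, the two morphisms being coequalized agree, so the projection
from `_σJ_δ ⊗ _δJ_τ` to the relative tensor product is an isomorphism. -/
theorem isIso_mJbar_iff (σ δ τ : Z A →ₗ[End (𝟙_ C)] Z A) [IsIso (uJ δ)] :
    IsIso (mJbar σ δ τ) ↔ IsIso (mJ σ δ τ) := by
  have hr : (J σ δ : C) ◁ uJ δ ≫ mJ σ δ δ = (ρ_ _).hom := by
    rw [← cancel_mono (J σ δ).arrow, Category.assoc, mJ_arrow, ← star_comp_right, uJ_arrow,
      star_one]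
  have hl : uJ δ ▷ (J δ τ : C) ≫ mJ δ δ τ = (λ_ _).hom := by
    rw [← cancel_mono (J δ τ).arrow, Category.assoc, mJ_arrow, ← star_comp_left, uJ_arrow,
      one_star]
  have h : mJ σ δ δ ▷ (J δ τ : C) = (α_ _ _ _).hom ≫ (J σ δ : C) ◁ mJ δ δ τ := by
    -- After inserting the invertible unit `uJ δ` in the middle factor, the unit laws `hr` and `hl`
    -- reduce the claim to the triangle identity.
    rw [← cancel_epi (((J σ δ : C) ◁ uJ δ) ▷ (J δ τ : C)), ← comp_whiskerRight, hr,
      whisker_assoc_assoc, Iso.inv_hom_id_assoc, ← whiskerLeft_comp, hl, triangle]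
  have hπ : IsIso (coequalizer.π (mJ σ δ δ ▷ (J δ τ : C))
      ((α_ _ _ _).hom ≫ (J σ δ : C) ◁ mJ δ δ τ)) := coequalizer.π_of_eq h
  have hd : coequalizer.π (mJ σ δ δ ▷ (J δ τ : C)) ((α_ _ _ _).hom ≫ (J σ δ : C) ◁ mJ δ δ τ) ≫
      mJbar σ δ τ = mJ σ δ τ := coequalizer.π_desc _ _
  rw [← hd]
  exact (@isIso_comp_left_iff _ _ _ _ _ _ _ hπ).symm

theorem isIso_mJ_iff (σ δ τ : Z A →ₗ[End (𝟙_ C)] Z A) :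
    IsIso (mJ σ δ τ) ↔ OverIso (star (J σ δ).arrow (J δ τ).arrow) (J σ τ).arrow := by
  constructor
  · intro h
    exact ⟨asIso (mJ σ δ τ), mJ_arrow σ δ τ⟩
  · rintro ⟨e, he⟩
    have : mJ σ δ τ = e.hom := by rw [← cancel_mono (J σ τ).arrow, mJ_arrow, he]
    rw [this]
    infer_instance

theorem mem_GSet_iff [IsIso (u₁ A)] (θ : Z A ≃ₐ[End (𝟙_ C)] Z A) : θ ∈ GSet A ↔
    IsTwoSidedInverse (J θ.toLinearMap LinearMap.id) (J LinearMap.id θ.toLinearMap) := by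
  have := isIso_uJ θ
  have h : IsIso (uJ (LinearMap.id : Z A →ₗ[End (𝟙_ C)] Z A)) := inferInstanceAs (IsIso (u₁ A))
  have hθ := overIso_J_self θ
  -- The case of the identity automorphism, brought back to `LinearMap.id` by the next rewrite.
  have h1 := overIso_J_self (AlgEquiv.refl : Z A ≃ₐ[End (𝟙_ C)] Z A)
  rw [J_algEquiv_self] at h1
  rw [isTwoSidedInverse_iff, GSet, Set.mem_ofPred_eq, isIso_mJbar_iff, isIso_mJbar_iff,
    isIso_mJ_iff, isIso_mJ_iff]
  exact and_congr ⟨fun k => k.trans hθ, fun k => k.trans hθ.symm⟩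
    ⟨fun k => k.trans h1, fun k => k.trans h1.symm⟩

/-- The product lands in `_1J_σ · _σJ_1 ⊆ _1J_1`, and inverting `u_1` carries it to `𝟙`. This
supplies the morphism `k` needed in `le_of_factors_star` and `le_of_star_factors`. -/
theorem factors_star_of_le [IsIso (u₁ A)] {σ : Z A →ₗ[End (𝟙_ C)] Z A} {P Q : Subobject A}
    (hP : P ≤ J LinearMap.id σ) (hQ : Q ≤ J σ LinearMap.id) :
    ∃ k : (P : C) ⊗ (Q : C) ⟶ 𝟙_ C, k ≫ η[A] = star P.arrow Q.arrow := by
  refine ⟨(Subobject.ofLE _ _ hP ⊗ₘ Subobject.ofLE _ _ hQ) ≫ mJ _ _ _ ≫ inv (u₁ A), ?_⟩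
  have e : inv (u₁ A) ≫ η[A] = (J LinearMap.id LinearMap.id).arrow := by
    rw [IsIso.inv_comp_eq, uJ_arrow]
  rw [Category.assoc, Category.assoc, e, mJ_arrow, tensor_star, Subobject.ofLE_arrow,
    Subobject.ofLE_arrow]

/-! ### Recovering `X` from `Φ_X`, and the range of `Φ` -/

variable [Penrose C]

theorem sub_le_J (X : Inv A) : X.sub ≤ J (miyashitaAction X).toLinearMap LinearMap.id :=
  (le_J_iff _ _ _).mpr (miyashitaAction_lact X)

theorem inverse_sub_le_J [IsIso (u₁ A)] (X : Inv A) :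
    X.inverse.sub ≤ J LinearMap.id (miyashitaAction X).toLinearMap := by
  refine (le_J_iff _ _ _).mpr fun t => ?_
  -- Evaluating the identity for `X⁻¹` at `Φ_X(t)` turns its left factor `Φ_{X⁻¹}(Φ_X(t))` into `t`.
  have h := miyashitaAction_lact X⁻¹ (miyashitaAction X t)
  rwa [← AlgEquiv.mul_apply, ← miyashitaAction_mul, inv_mul_cancel,
    show miyashitaAction (1 : Inv A) = 1 from (miyashitaHom A).map_one] at h

/-- An invertible subobject is recovered from its Miyashita automorphism. -/
theorem J_miyashitaAction_left [IsIso (u₁ A)] (X : Inv A) :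
    J (miyashitaAction X).toLinearMap LinearMap.id = X.sub := by
  refine le_antisymm ?_ (sub_le_J X)
  obtain ⟨k, hk⟩ := factors_star_of_le (inverse_sub_le_J X) le_rfl
  exact le_of_factors_star X.isTwoSidedInverse k hk

theorem J_miyashitaAction_right [IsIso (u₁ A)] (X : Inv A) :
    J LinearMap.id (miyashitaAction X).toLinearMap = X.inverse.sub := by
  refine le_antisymm ?_ (inverse_sub_le_J X)
  obtain ⟨k, hk⟩ := factors_star_of_le le_rfl (sub_le_J X)
  exact le_of_star_factors X.isTwoSidedInverse.symm k hk

theorem miyashitaAction_mem_GSet [IsIso (u₁ A)] (X : Inv A) : miyashitaAction X ∈ GSet A := by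
  rw [mem_GSet_iff, J_miyashitaAction_left, J_miyashitaAction_right]
  exact X.isTwoSidedInverse

theorem miyashitaHom_injective [IsIso (u₁ A)] : Function.Injective (miyashitaHom A) := by
  intro X Y h
  have h' : miyashitaAction X = miyashitaAction Y := h
  exact Inv.ext (by rw [← J_miyashitaAction_left X, h', J_miyashitaAction_left])

theorem range_miyashitaHom [IsIso (u₁ A)] : Set.range (miyashitaHom A) = GSet A := by
  refine Set.Subset.antisymm (Set.range_subset_iff.mpr miyashitaAction_mem_GSet) fun θ hθ => ?_
  let X : Inv A := ⟨J θ.toLinearMap LinearMap.id, _, (mem_GSet_iff θ).mp hθ⟩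
  -- The equation defining `_θJ_1` is the characterizing identity of `Φ_X(t)` with `θ(t)` in its
  -- place.
  exact ⟨X, AlgEquiv.ext fun t => X.phiMap_eq (J_arrow θ.toLinearMap LinearMap.id t)⟩

end InvariantSubobjects

end

end Miyashita

/-! ### The main theorem -/

theorem mainTheorem1 {C : Type u} [Category.{v} C] [MonoidalCategory C] [Abelian C]
    [MonoidalPreadditive C] [Miyashita.Penrose C] [WellPowered.{v} C] [HasLimits C] [HasColimits C]
    [∀ X : C, PreservesFiniteColimits (tensorLeft X)]
    [∀ X : C, PreservesFiniteColimits (tensorRight X)]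
    (A : C) [MonObj A] [IsIso (Miyashita.u₁ A)] :
    ∃ (G : Subgroup (Miyashita.Z A ≃ₐ[End (𝟙_ C)] Miyashita.Z A)) (Φhat : Miyashita.Inv A ≃* G),
      (G : Set (Miyashita.Z A ≃ₐ[End (𝟙_ C)] Miyashita.Z A)) = Miyashita.GSet A ∧
      (∀ X : Miyashita.Inv A,
        (Φhat X : Miyashita.Z A ≃ₐ[End (𝟙_ C)] Miyashita.Z A) = Miyashita.miyashitaAction X) ∧
      ∀ θ : G, (Φhat.symm θ).sub = Miyashita.J (θ : Miyashita.Z A ≃ₐ[End (𝟙_ C)] Miyashita.Z A).toLinearMap LinearMap.id := by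
  let Φhat := (Miyashita.miyashitaHom A).ofInjective Miyashita.miyashitaHom_injective
  refine ⟨(Miyashita.miyashitaHom A).range, Φhat, ?_, fun X => rfl, fun θ => ?_⟩
  · rw [MonoidHom.coe_range, Miyashita.range_miyashitaHom]
  · have h : Miyashita.miyashitaAction (Φhat.symm θ) = θ :=
      congrArg Subtype.val (Φhat.apply_symm_apply θ)
    -- The preimage of `θ` equals the `J` of its own automorphism, and that automorphism is `θ`.
    rw [← Miyashita.J_miyashitaAction_left, h]
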